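/- **Model.** A radio network is a finite undirected graph whose vertices are processors acting in synchronous rounds. In every round each processor either transmits or keeps silent; a processor receives something in a round if and only if it keeps silent and precisely one of its neighbours transmits (a collision is not distinguishable from silence). A broadcast starts at a source. Only processors that already hold the message (the source, and those that have received a transmission before) may transmit; there are no spontaneous transmissions. A transmission carries the message and may carry arbitrary further content from a countable alphabet. A randomized protocol determines, from the random coins, the name of a vertex and the list of what that vertex has received in the past rounds, whether and what the vertex transmits. The protocol is fixed, and the coins are drawn, independently of the random choices made in constructing the network below; so it may depend on everything else, including the number of vertices and the diameter. **Core graph.** Let $s=2^m$, $m\ge 0$, and let $\log$ denote the logarithm to base 2. Take a perfect binary tree with $s$ leaves; let $S$ be its set of leaves, and let $N$ be the disjoint union of sets $N_w$ over all tree nodes $w$, where $|N_w|=2^j$ if $w$ has height $j$ above the leaves. A leaf $z\in S$ is adjacent to $v\in N_w$ if and only if $w$ is an ancestor of $z$ (or $z$ itself). Thus $|S|=s$ and $|N|=s\log 2s$. **Chain.** For $k\ge1$, take $k$ copies of the core graph with sides $S^i,N^i$, $1\le i\le k$, and a root $rt=rt^0$; choose $rt^i\in N^i$ uniformly at random, independently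 for $1\le i\le k$, and join $rt^{i-1}$ to all vertices of $S^i$ for $1\le i\le k$. The chain has $1+k\,s\log 4s$ vertices. **Theorem.** (1) Let a broadcast start at the root $rt$ joined to all vertices of $S$ in a single core graph, let $0\le i\le(\log 2s)/2$ be a real number, and consider any protocol and any outcome of its coins. If after $t$ rounds the message has reached at least one vertex, and at least a $\bigl(2i/\log 2s\bigr)$-fraction, of $N$, then $t\ge 1+i$. (2) There are a constant $c>0$ and, for every real $C$, a constant $A_C$ such that the following holds for all integers $D\ge 2$ and $n\ge 2\lfloor D/2\rfloor+1$. Let $s$ be the largest power of two for which the chain of $k=\lfloor D/2\rfloor$ core graphs has at most $n$ vertices; it then has at least $n/3$ vertices. For every choice of the vertices $rt^i$, the chain is connected and its diameter lies between $2k$ and $2k+2$. Let $R$ be the number of rounds until the message, broadcast from $rt$, reaches $rt^{k}$, and let $T\ge R$ be the number of rounds until it has reached all vertices ($\infty$ if this never happens). For every randomized protocol, with probability taken over the choice of the $rt^i$ and the coins of the protocol, * $\mathbb E(R)\ge c\,D\log(n/D)$ and $\mathbb E(T)\ge c\,D\log(n/D)$; * for every real $C$ with $D\ge A_C\log n$: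 $\ \mathbb P\bigl(R\ge c\,D\log(n/D)\bigr)\ge 1-n^{-C}$ and $\mathbb P\bigl(T\ge c\,D\log(n/D)\bigr)\ge 1-n^{-C}$. -/

import Mathlib

namespace RadioBroadcast

/-! ### Radio networks

Processors sit at the vertices of a graph and act in synchronous rounds. -/

section Radio

variable {V M : Type*}

/-- A (deterministic) strategy: what a processor sitting at a given vertex does in the coming round,
as a function of the list of everything it received in the past rounds (most recent round first;
the entry is `none` if nothing was received in that round). The value `some a` means that it
transmits the content `a`, the value `none` that it keeps silent. The strategy is not told the
graph; the list has one entry per past round, so the processors share a clock. -/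
abbrev Strategy (V M : Type*) : Type _ := V → List (Option M) → Option M

open Classical in
/-- What `v` receives if every vertex `u` performs `a u`: the content sent by a neighbour of `v`, if
`v` keeps silent and precisely one neighbour transmits; otherwise nothing (a collision cannot be
distinguished from silence). -/
noncomputable def received (G : SimpleGraph V) (a : V → Option M) (v : V) : Option M :=
  if h : a v = none ∧ ∃! u, G.Adj v u ∧ a u ≠ none then a h.2.choose else none

/-- A vertex is active if it is the source or has received a transmission before. Every
transmission carries the broadcast message (plus arbitrary additional content). -/
def Active (src v : V) (h : List (Option M)) : Prop :=
  v = src ∨ ∃ a : M, some a ∈ h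

open Classical in
/-- The action of `v`: it follows the strategy once it holds the message, and keeps silent before
(there are no spontaneous transmissions). -/
noncomputable def action (src : V) (σ : Strategy V M) (v : V) (h : List (Option M)) : Option M :=
  if Active src v h then σ v h else none

/-- The list of what `v` received in the first `t` rounds of a broadcast started at `src`. -/
noncomputable def history (G : SimpleGraph V) (src : V) (σ : Strategy V M) :
    ℕ → V → List (Option M)
  | 0, _ => []
  | t + 1, v =>
      received G (fun u => action src σ u (history G src σ t u)) v :: history G src σ t v

/-- The broadcast message has reached `v` within `t` rounds. -/
def Informed (G : SimpleGraph V) (src : V) (σ : Strategy V M) (t : ℕ) (v : V) : Prop :=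
  Active src v (history G src σ t v)

/-- The number of rounds until the message reaches `v` (`⊤` if it never does). -/
noncomputable def reachTime (G : SimpleGraph V) (src : V) (σ : Strategy V M) (v : V) : ℕ∞ :=
  ⨅ (t : ℕ) (_ : Informed G src σ t v), (t : ℕ∞)

/-- The number of rounds until the message has reached all vertices (`⊤` if this never happens). -/
noncomputable def broadcastTime (G : SimpleGraph V) (src : V) (σ : Strategy V M) : ℕ∞ :=
  ⨅ (t : ℕ) (_ : ∀ v, Informed G src σ t v), (t : ℕ∞)

end Radio

/-! ### The core graph, for `s = 2 ^ m`

The perfect binary tree with `s` leaves `0, …, s - 1`: the ancestor of the leaf `z` at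
inverse-level `j` (height `j` above the leaves) is the node number `z / 2 ^ j` of that
inverse-level. -/

/-- The side `S` of the core graph: the leaves of the tree. -/
abbrev CoreS (m : ℕ) : Type := Fin (2 ^ m)

/-- The side `N` of the core graph: `s` vertices for each inverse-level `j = 0, …, m`. The vertex
`(j, y)` belongs to the set `N_w` of the node `w` number `y / 2 ^ j` at inverse-level `j`, so that
`N_w` has `2 ^ j` elements. -/
abbrev CoreN (m : ℕ) : Type := Fin (m + 1) × Fin (2 ^ m)

/-- A leaf `z` is adjacent to all elements of `N_w` for all its ancestors `w` (including itself). -/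
def CoreAdj {m : ℕ} (z : CoreS m) (v : CoreN m) : Prop :=
  z.val / 2 ^ v.1.val = v.2.val / 2 ^ v.1.val

/-! ### The chain of `k` core graphs -/

/-- The vertices of the chain: the root (`none`) and `k` copies of the core graph. -/
abbrev ChainVertex (k m : ℕ) : Type := Option (Fin k × (CoreS m ⊕ CoreN m))

/-- The root `rt = rt⁰`. -/
def root {k m : ℕ} : ChainVertex k m := none

/-- The vertex `z` of the side `S` of copy `i`. -/
def inS {k m : ℕ} (i : Fin k) (z : CoreS m) : ChainVertex k m := some (i, Sum.inl z)

/-- The vertex `v` of the side `N` of copy `i`. -/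
def inN {k m : ℕ} (i : Fin k) (v : CoreN m) : ChainVertex k m := some (i, Sum.inr v)

/-- The vertices `rt⁰, rt¹, …, rtᵏ`: the root, followed by the vertex `g i` that was selected in the
side `N` of each copy. -/
def relay {k m : ℕ} (g : Fin k → CoreN m) : Fin (k + 1) → ChainVertex k m :=
  Fin.cases root (fun i => inN i (g i))

/-- The chain: in each copy the edges of the core graph, and all edges between the side `S` of a
copy and the relay vertex that precedes the copy. -/
def chain {k m : ℕ} (g : Fin k → CoreN m) : SimpleGraph (ChainVertex k m) :=
  SimpleGraph.fromRel fun x y =>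
    ∃ (i : Fin k) (z : CoreS m), y = inS i z ∧
      (x = relay g i.castSucc ∨ ∃ v : CoreN m, x = inN i v ∧ CoreAdj z v)

/-- The law of the selected vertices: independent and uniform in the sides `N` of the copies. -/
noncomputable def selection (k m : ℕ) : MeasureTheory.Measure (Fin k → CoreN m) :=
  MeasureTheory.Measure.pi fun _ => ProbabilityTheory.uniformOn Set.univ

end RadioBroadcast

open RadioBroadcast MeasureTheory

/-!
Whatever set of leaves of a core graph transmits, the nodes of a subtree with `r` leaves contribute
at most `2 r` vertices of `N` with precisely one transmitting neighbour: if the root of the subtree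
contributes, then it has a unique transmitting descendant, and one of its two subtrees contributes
nothing. Hence each round informs at most `2 s` of the `s log 2s` vertices of `N`, which gives the
bound for a single core graph.

In the chain, the relay vertex is hidden in the side `N` of its copy. With the later copies cut
off, the first `(log 2s) / 32` rounds in a copy do not depend on the selected relay vertex and reach
at most `1 / 16` of `N`, so, given the earlier choices, the copy is fast with probability at most
`1 / 16`. The number of fast copies thus has an exponential moment bounded by that of independent
events, and by Markov's inequality more than half of the copies are slow, except with probability
`2⁻ᵏ`. The message needs more than `(log 2s) / 32` rounds in each slow copy.
-/

namespace RadioBroadcast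

/-! ### Unique neighbours in the core graph -/

section UniqueNeighbours

open Classical in
/-- Indicator of the node number `w` at height `j` having exactly one descendant leaf in `X`. -/
noncomputable def uniqueLeaf (X : Set ℕ) (j w : ℕ) : ℕ :=
  if ∃! x, x ∈ X ∧ x / 2 ^ j = w then 1 else 0

/-- The number of vertices of `N` that are attached to the nodes of the subtree of the node
number `w` at height `j` and have exactly one neighbour in `X`. -/
noncomputable def subtreeCount (X : Set ℕ) (j w : ℕ) : ℕ :=
  ∑ y ∈ Finset.Ico (w * 2 ^ j) ((w + 1) * 2 ^ j),
    ∑ l ∈ Finset.range (j + 1), uniqueLeaf X l (y / 2 ^ l)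

theorem uniqueLeaf_le_one (X : Set ℕ) (j w : ℕ) : uniqueLeaf X j w ≤ 1 := by
  unfold uniqueLeaf; split_ifs <;> omega

theorem div_two_pow_succ (x j : ℕ) : x / 2 ^ (j + 1) = x / 2 ^ j / 2 := by
  rw [pow_succ, Nat.div_div_eq_div_mul]

theorem subtreeCount_succ (X : Set ℕ) (j w : ℕ) :
    subtreeCount X (j + 1) w =
      2 ^ (j + 1) * uniqueLeaf X (j + 1) w +
        (subtreeCount X j (2 * w) + subtreeCount X j (2 * w + 1)) := by
  have top_level : ∑ y ∈ Finset.Ico (w * 2 ^ (j + 1)) ((w + 1) * 2 ^ (j + 1)),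
      uniqueLeaf X (j + 1) (y / 2 ^ (j + 1)) = 2 ^ (j + 1) * uniqueLeaf X (j + 1) w := by
    rw [Finset.sum_congr rfl (g := fun _ => uniqueLeaf X (j + 1) w)]
    · rw [Finset.sum_const, Nat.card_Ico, ← Nat.sub_mul, smul_eq_mul, Nat.add_sub_cancel_left,
        one_mul]
    · intro y hy
      rw [Finset.mem_Ico] at hy
      rw [Nat.div_eq_of_lt_le hy.1 hy.2]
  have hmid : (2 * w + 1) * 2 ^ j = w * 2 ^ (j + 1) + 2 ^ j := by ring
  have hright : (w + 1) * 2 ^ (j + 1) = (2 * w + 1) * 2 ^ j + 2 ^ j := by ring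
  unfold subtreeCount
  simp_rw [Finset.sum_range_succ _ (j + 1)]
  rw [Finset.sum_add_distrib, top_level, add_comm,
    ← Finset.sum_Ico_consecutive _ (m := w * 2 ^ (j + 1)) (n := (2 * w + 1) * 2 ^ j)
      (hmid ▸ Nat.le_add_right _ _) (hright ▸ Nat.le_add_right _ _)]
  congr 4 <;> ring

theorem subtreeCount_eq_zero {X : Set ℕ} {j w : ℕ} (h : ∀ x ∈ X, x / 2 ^ j ≠ w) :
    subtreeCount X j w = 0 := by
  refine Finset.sum_eq_zero fun y hy => Finset.sum_eq_zero fun l hl => if_neg ?_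
  rintro ⟨x, ⟨hx, hxy⟩, -⟩
  rw [Finset.mem_Ico] at hy
  have hlj : 2 ^ j = 2 ^ l * 2 ^ (j - l) := by
    rw [← pow_add, Nat.add_sub_cancel' (Finset.mem_range_succ_iff.1 hl)]
  refine h x hx ?_
  rw [← Nat.div_eq_of_lt_le hy.1 hy.2, hlj, ← Nat.div_div_eq_div_mul, hxy,
    Nat.div_div_eq_div_mul]

theorem subtreeCount_le (X : Set ℕ) (j w : ℕ) : subtreeCount X j w ≤ 2 ^ (j + 1) := by
  induction j generalizing w with
  | zero => simpa [subtreeCount] using (uniqueLeaf_le_one X 0 w).trans one_le_two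
  | succ j ih =>
    rw [subtreeCount_succ, pow_succ 2 (j + 1)]
    have hleft := ih (2 * w)
    have hright := ih (2 * w + 1)
    by_cases hu : ∃! x, x ∈ X ∧ x / 2 ^ (j + 1) = w
    · rw [uniqueLeaf, if_pos hu]
      obtain ⟨x, -, hx⟩ := hu
      have eq_of_child {c : ℕ} (hc : c / 2 = w) (y : ℕ) (hy : y ∈ X) (hyc : y / 2 ^ j = c) :
          c = x / 2 ^ j := by
        rw [← hx y ⟨hy, by rw [div_two_pow_succ, hyc, hc]⟩, hyc]
      have one_empty :
          subtreeCount X j (2 * w) = 0 ∨ subtreeCount X j (2 * w + 1) = 0 := by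
        by_cases hxw : x / 2 ^ j = 2 * w
        · refine .inr (subtreeCount_eq_zero fun y hy hyw => ?_)
          have := eq_of_child (by omega) y hy hyw
          omega
        · refine .inl (subtreeCount_eq_zero fun y hy hyw => ?_)
          exact hxw (eq_of_child (by omega) y hy hyw).symm
      omega
    · rw [uniqueLeaf, if_neg hu]
      omega

theorem ncard_existsUnique_coreAdj_le {m : ℕ} (X : Set (CoreS m)) :
    {v : CoreN m | ∃! z, z ∈ X ∧ CoreAdj z v}.ncard ≤ 2 * 2 ^ m := by
  classical
  have exists_unique_val (v : CoreN m) (h : ∃! z, z ∈ X ∧ CoreAdj z v) :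
      ∃! x, x ∈ Fin.val '' X ∧ x / 2 ^ v.1.val = v.2.val / 2 ^ v.1.val := by
    obtain ⟨z, ⟨hz, hzv⟩, hu⟩ := h
    refine ⟨z.val, ⟨⟨z, hz, rfl⟩, hzv⟩, ?_⟩
    rintro _ ⟨⟨y, hy, rfl⟩, hyv⟩
    rw [hu y ⟨hy, hyv⟩]
  rw [Set.ncard_eq_toFinset_card', Set.toFinset_ofFinset, Finset.card_filter]
  calc ∑ v : CoreN m, (if ∃! z, z ∈ X ∧ CoreAdj z v then 1 else 0)
      ≤ ∑ v : CoreN m, uniqueLeaf (Fin.val '' X) v.1.val (v.2.val / 2 ^ v.1.val) := by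
        refine Finset.sum_le_sum fun v _ => ?_
        unfold uniqueLeaf
        split_ifs with h h' <;> first | exact absurd (exists_unique_val v h) h' | omega
    _ = subtreeCount (Fin.val '' X) m 0 := by
        rw [Fintype.sum_prod_type, Finset.sum_comm]
        simp only [subtreeCount, zero_mul, zero_add, one_mul, ← Finset.range_eq_Ico,
          Finset.sum_range]
    _ ≤ 2 ^ (m + 1) := subtreeCount_le _ _ _
    _ = 2 * 2 ^ m := by ring

end UniqueNeighbours

/-! ### Broadcasts in general graphs -/

section Dynamics

variable {V M : Type*} {G : SimpleGraph V} {src v : V} {σ : Strategy V M} {t : ℕ}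

theorem informed_of_action_ne_none (h : action src σ v (history G src σ t v) ≠ none) :
    Informed G src σ t v := by
  by_contra hn
  exact h (if_neg hn)

theorem not_informed_zero (hv : v ≠ src) : ¬ Informed G src σ 0 v := by
  rintro (h | ⟨a, ha⟩)
  · exact hv h
  · exact List.not_mem_nil ha

theorem Informed.mono {t' : ℕ} (htt : t ≤ t') (h : Informed G src σ t v) :
    Informed G src σ t' v := by
  induction htt with
  | refl => exact h
  | step _ ih => exact ih.imp_right fun ⟨a, ha⟩ => ⟨a, List.mem_cons_of_mem _ ha⟩

theorem existsUnique_of_received_ne_none {a : V → Option M} (h : received G a v ≠ none) :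
    ∃! u, G.Adj v u ∧ a u ≠ none := by
  unfold received at h
  split_ifs at h with h'
  · exact h'.2
  · exact absurd rfl h

theorem Informed.existsUnique_adj (h : Informed G src σ (t + 1) v) (h' : ¬ Informed G src σ t v) :
    ∃! u, G.Adj v u ∧ action src σ u (history G src σ t u) ≠ none := by
  rcases h with h | ⟨a, ha⟩
  · exact absurd (.inl h) h'
  · rcases List.mem_cons.1 ha with ha | ha
    · exact existsUnique_of_received_ne_none (ha ▸ Option.some_ne_none a)
    · exact absurd (.inr ⟨a, ha⟩) h'

theorem Informed.exists_adj (h : Informed G src σ (t + 1) v) (hv : v ≠ src) :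
    ∃ u, G.Adj v u ∧ Informed G src σ t u := by
  induction t with
  | zero =>
    obtain ⟨u, ⟨hadj, hu⟩, -⟩ := h.existsUnique_adj (not_informed_zero hv)
    exact ⟨u, hadj, informed_of_action_ne_none hu⟩
  | succ t ih =>
    by_cases ht : Informed G src σ (t + 1) v
    · obtain ⟨u, hadj, hu⟩ := ih ht
      exact ⟨u, hadj, hu.mono t.le_succ⟩
    · obtain ⟨u, ⟨hadj, hu⟩, -⟩ := h.existsUnique_adj ht
      exact ⟨u, hadj, informed_of_action_ne_none hu⟩

theorem reachTime_le_iff : reachTime G src σ v ≤ t ↔ Informed G src σ t v := by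
  refine ⟨fun h => ?_, fun h => iInf₂_le t h⟩
  have hlt : reachTime G src σ v < (t + 1 : ℕ) := h.trans_lt (by exact_mod_cast t.lt_succ_self)
  simp only [reachTime, iInf_lt_iff] at hlt
  obtain ⟨t', ht', hlt⟩ := hlt
  exact ht'.mono (Nat.lt_succ_iff.1 (by exact_mod_cast hlt))

theorem reachTime_le_broadcastTime (v : V) : reachTime G src σ v ≤ broadcastTime G src σ :=
  le_iInf₂ fun _ ht => reachTime_le_iff.2 (ht v)

theorem reachTime_add_one_le_of_boundary {U : Set V} {w : V} (hsrc : src ∉ U)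
    (hU : ∀ x ∈ U, ∀ y ∉ U, G.Adj x y → y = w) (hv : v ∈ U) :
    reachTime G src σ w + 1 ≤ reachTime G src σ v := by
  refine le_iInf₂ fun t ht => ?_
  induction t generalizing v with
  | zero => exact absurd ht (not_informed_zero fun h => hsrc (h ▸ hv))
  | succ t ih =>
    obtain ⟨u, hadj, hu⟩ := ht.exists_adj fun h => hsrc (h ▸ hv)
    by_cases huU : u ∈ U
    · exact (ih huU hu).trans (by exact_mod_cast t.le_succ)
    · obtain rfl := hU v hv u huU hadj
      exact_mod_cast add_le_add_left (reachTime_le_iff.2 hu) 1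

theorem received_congr {G' : SimpleGraph V} {a a' : V → Option M} (hv : a v = a' v)
    (hadj : ∀ u, (G.Adj v u ∧ a u ≠ none) ↔ (G'.Adj v u ∧ a' u ≠ none))
    (ha : ∀ u, G.Adj v u → a u ≠ none → a u = a' u) : received G a v = received G' a' v := by
  have hiff : (a v = none ∧ ∃! u, G.Adj v u ∧ a u ≠ none) ↔
      (a' v = none ∧ ∃! u, G'.Adj v u ∧ a' u ≠ none) := by
    simp only [hv, hadj]
  unfold received
  split_ifs with h h' h'
  · have hsend := h.2.choose_spec.1
    have hsender : h.2.choose = h'.2.choose :=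
      h'.2.unique ((hadj _).1 hsend) h'.2.choose_spec.1
    rw [ha _ hsend.1 hsend.2, hsender]
  · exact absurd (hiff.1 h) h'
  · exact absurd (hiff.2 h') h
  · rfl

theorem history_eq_history_induce {U : Set V}
    (h : ∀ t' < t, ∀ y ∉ U, ¬ Informed G src σ t' y) (hv : v ∈ U) :
    history G src σ t v = history (G.induce U).spanningCoe src σ t v := by
  induction t generalizing v with
  | zero => rfl
  | succ t ih =>
    have ih {u : V} (hu : u ∈ U) := ih (fun t' ht' => h t' (by omega)) hu
    have silent {u : V} (hu : u ∉ U) : action src σ u (history G src σ t u) = none := by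
      by_contra hne
      exact h t t.lt_succ_self u hu (informed_of_action_ne_none hne)
    rw [history, history, ih hv]
    congr 1
    refine received_congr (by rw [ih hv]) (fun u => ?_) fun u _ hu => ?_ <;> by_cases huU : u ∈ U
    · simp [ih huU, hv, huU]
    · simp [silent huU, huU]
    · rw [ih huU]
    · exact absurd (silent huU) hu

section Counting

variable {ι : Type*} [Finite ι] {n : ι → V} {q : ℕ}

theorem ncard_informed_le (hn : ∀ a, n a ≠ src)
    (hq : ∀ X : Set V, {a | ∃! u, G.Adj (n a) u ∧ u ∈ X}.ncard ≤ q)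
    (hb : ∀ a u, G.Adj (n a) u → ¬ Informed G src σ t u) (j : ℕ) :
    {a | Informed G src σ (t + 1 + j) (n a)}.ncard ≤ j * q := by
  induction j with
  | zero =>
    rw [zero_mul, Nat.le_zero, Set.ncard_eq_zero, Set.eq_empty_iff_forall_notMem]
    intro a ha
    obtain ⟨u, hadj, hu⟩ := Informed.exists_adj ha (hn a)
    exact hb a u hadj hu
  | succ j ih =>
    let transmitters : Set V := {u | action src σ u (history G src σ (t + 1 + j) u) ≠ none}
    calc {a | Informed G src σ (t + 1 + j + 1) (n a)}.ncard
        ≤ ({a | Informed G src σ (t + 1 + j) (n a)} ∪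
            {a | ∃! u, G.Adj (n a) u ∧ u ∈ transmitters}).ncard :=
          Set.ncard_le_ncard fun a ha => or_iff_not_imp_left.2 ha.existsUnique_adj
      _ ≤ j * q + q := (Set.ncard_union_le _ _).trans (add_le_add ih (hq transmitters))
      _ = (j + 1) * q := by ring

theorem ncard_exists_informed_le (hn : ∀ a, n a ≠ src)
    (hq : ∀ X : Set V, {a | ∃! u, G.Adj (n a) u ∧ u ∈ X}.ncard ≤ q) (j : ℕ) :
    {a | ∃ b, (∀ a' u, G.Adj (n a') u → ¬ Informed G src σ b u) ∧
      Informed G src σ (b + 1 + j) (n a)}.ncard ≤ j * q := by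
  set A := {a | ∃ b, (∀ a' u, G.Adj (n a') u → ¬ Informed G src σ b u) ∧
    Informed G src σ (b + 1 + j) (n a)}
  rcases A.eq_empty_or_nonempty with hA | hA
  · simp [hA]
  choose! b hb_silent hb using fun a (ha : a ∈ A) => ha
  obtain ⟨a₀, ha₀, hmax⟩ := Set.exists_max_image A b A.toFinite hA
  refine le_trans (Set.ncard_le_ncard fun a ha => ?_)
    (ncard_informed_le hn hq (hb_silent a₀ ha₀) j)
  exact (hb a ha).mono (by have := hmax a ha; omega)

end Counting

end Dynamics

/-! ### Broadcasts on the chain -/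

section Chain

variable {k m : ℕ} {M : Type*} {g g' : Fin k → CoreN m} {i : Fin k}

/-- The distance from the root, which is the same for all choices of the relay vertices: `2 j + 1`
on the side `S` and `2 j + 2` on the side `N` of copy `j`. -/
def level : ChainVertex k m → ℕ
  | none => 0
  | some (j, .inl _) => 2 * j + 1
  | some (j, .inr _) => 2 * j + 2

theorem level_root : level (root : ChainVertex k m) = 0 := rfl

theorem level_inS (z : CoreS m) : level (inS i z) = 2 * i + 1 := rfl

theorem level_inN (v : CoreN m) : level (inN i v) = 2 * i + 2 := rfl

theorem level_relay (g : Fin k → CoreN m) (j : Fin (k + 1)) : level (relay g j) = 2 * j := by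
  cases j using Fin.cases <;> rfl

theorem level_le (x : ChainVertex k m) : level x ≤ 2 * k := by
  rcases x with _ | ⟨j, z | v⟩
  · exact Nat.zero_le _
  all_goals
    have := j.isLt
    simp only [level]
    omega

theorem relay_congr {j : Fin (k + 1)} (h : ∀ l : Fin k, l.castSucc < j → g l = g' l) :
    relay g j = relay g' j := by
  cases j using Fin.cases with
  | zero => rfl
  | succ l => exact congrArg (inN l) (h l l.castSucc_lt_succ)

theorem chain_adj_iff {x y : ChainVertex k m} : (chain g).Adj x y ↔
    (∃ (j : Fin k) (z : CoreS m), y = inS j z ∧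
      (x = relay g j.castSucc ∨ ∃ v : CoreN m, x = inN j v ∧ CoreAdj z v)) ∨
    (∃ (j : Fin k) (z : CoreS m), x = inS j z ∧
      (y = relay g j.castSucc ∨ ∃ v : CoreN m, y = inN j v ∧ CoreAdj z v)) := by
  rw [chain, SimpleGraph.fromRel_adj, and_iff_right_of_imp]
  rintro h rfl
  rw [or_self] at h
  obtain ⟨j, z, hx, h | ⟨v, h, -⟩⟩ := h <;> have := congrArg level (hx.symm.trans h)
  · rw [level_inS, level_relay, Fin.val_castSucc] at this
    omega
  · rw [level_inS, level_inN] at this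
    omega

theorem relay_adj_inS (j : Fin k) (z : CoreS m) : (chain g).Adj (relay g j.castSucc) (inS j z) :=
  chain_adj_iff.2 (.inl ⟨j, z, rfl, .inl rfl⟩)

theorem inN_adj_inS {j : Fin k} {z : CoreS m} {v : CoreN m} (h : CoreAdj z v) :
    (chain g).Adj (inN j v) (inS j z) :=
  chain_adj_iff.2 (.inl ⟨j, z, rfl, .inr ⟨v, rfl, h⟩⟩)

theorem level_eq_of_adj {x y : ChainVertex k m} (h : (chain g).Adj x y) :
    level x = level y + 1 ∨ level y = level x + 1 := by
  rcases chain_adj_iff.1 h with ⟨j, z, rfl, rfl | ⟨v, rfl, -⟩⟩ | ⟨j, z, rfl, rfl | ⟨v, rfl, -⟩⟩ <;>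
    simp [level_inS, level_inN, level_relay]

theorem eq_relay_of_adj {x y : ChainVertex k m} {j : Fin (k + 1)} (h : (chain g).Adj x y)
    (hx : 2 * j < level x) (hy : level y ≤ 2 * j) : y = relay g j := by
  rcases chain_adj_iff.1 h with ⟨l, z, rfl, rfl | ⟨v, rfl, -⟩⟩ | ⟨l, z, rfl, rfl | ⟨v, rfl, -⟩⟩ <;>
    simp only [level_inS, level_inN, level_relay, Fin.val_castSucc] at hx hy <;> try omega
  rw [show j = l.castSucc from Fin.ext (by rw [Fin.val_castSucc]; omega)]

theorem exists_of_inN_adj {v : CoreN m} {x : ChainVertex k m} (h : (chain g).Adj (inN i v) x)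
    (hx : level x ≤ 2 * i + 2) : ∃ z, x = inS i z ∧ CoreAdj z v := by
  rcases chain_adj_iff.1 h with ⟨j, z, rfl, h | ⟨v', h, hz⟩⟩ | ⟨j, z, h, -⟩
  · have := congrArg level h
    rw [level_inN, level_relay, Fin.val_castSucc] at this
    rw [level_inS] at hx
    omega
  · obtain ⟨rfl, rfl⟩ : i = j ∧ v = v' := by simpa [inN] using h
    exact ⟨z, rfl, hz⟩
  · simp [inN, inS] at h

/-- The chain without the edges of the copies after copy `i`. -/
def chainUpTo (g : Fin k → CoreN m) (i : Fin k) : SimpleGraph (ChainVertex k m) :=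
  ((chain g).induce {x | level x ≤ 2 * i + 2}).spanningCoe

theorem chainUpTo_adj_iff {x y : ChainVertex k m} : (chainUpTo g i).Adj x y ↔
    (chain g).Adj x y ∧ level x ≤ 2 * i + 2 ∧ level y ≤ 2 * i + 2 := by
  simp only [chainUpTo, SimpleGraph.map_adj, SimpleGraph.comap_adj,
    Function.Embedding.subtype_apply, Subtype.exists, Set.mem_ofPred_eq]
  grind

theorem chainUpTo_last {k : ℕ} (g : Fin (k + 1) → CoreN m) :
    chainUpTo g (Fin.last k) = chain g := by
  ext x y
  rw [chainUpTo_adj_iff, and_iff_left]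
  exact ⟨level_le x, level_le y⟩

theorem chainUpTo_le_chainUpTo (h : ∀ j < i, g j = g' j) : chainUpTo g i ≤ chainUpTo g' i := by
  intro x y hadj
  rw [chainUpTo_adj_iff] at hadj ⊢
  obtain ⟨hadj, hx, hy⟩ := hadj
  have relay_eq {j : Fin k} {z : CoreS m} (hj : level (inS j z) ≤ 2 * i + 2) :
      relay g j.castSucc = relay g' j.castSucc :=
    relay_congr fun l hl => h l (by
      rw [level_inS] at hj
      rw [Fin.castSucc_lt_castSucc_iff, Fin.lt_def] at hl
      exact Fin.lt_def.2 (by omega))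
  refine ⟨chain_adj_iff.2 ?_, hx, hy⟩
  refine (chain_adj_iff.1 hadj).imp ?_ ?_ <;> rintro ⟨j, z, rfl, hz⟩ <;>
    refine ⟨j, z, rfl, ?_⟩
  · rwa [← relay_eq hy]
  · rwa [← relay_eq hx]

theorem chainUpTo_congr (h : ∀ j < i, g j = g' j) : chainUpTo g i = chainUpTo g' i :=
  (chainUpTo_le_chainUpTo h).antisymm (chainUpTo_le_chainUpTo fun j hj => (h j hj).symm)

theorem chainUpTo_adj_inN {v : CoreN m} {x : ChainVertex k m} :
    (chainUpTo g i).Adj (inN i v) x ↔ ∃ z, x = inS i z ∧ CoreAdj z v := by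
  rw [chainUpTo_adj_iff]
  refine ⟨fun ⟨hadj, _, hx⟩ => exists_of_inN_adj hadj hx, ?_⟩
  rintro ⟨z, rfl, hz⟩
  exact ⟨inN_adj_inS hz, le_rfl, Nat.le_succ _⟩

theorem ncard_existsUnique_chainUpTo_adj_le (X : Set (ChainVertex k m)) :
    {v | ∃! u, (chainUpTo g i).Adj (inN i v) u ∧ u ∈ X}.ncard ≤ 2 * 2 ^ m := by
  refine le_trans (Set.ncard_le_ncard ?_) (ncard_existsUnique_coreAdj_le (inS i ⁻¹' X))
  rintro v ⟨u, ⟨hadj, hu⟩, huniq⟩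
  obtain ⟨z, rfl, hz⟩ := chainUpTo_adj_inN.1 hadj
  refine ⟨z, ⟨hu, hz⟩, fun y hy => ?_⟩
  simpa [inS] using huniq (inS i y) ⟨chainUpTo_adj_inN.2 ⟨y, rfl, hy.2⟩, hy.1⟩

variable {σ : Strategy (ChainVertex k m) M} {J : ℕ}

/-- The relay vertex of copy `i` is among the vertices of the side `N` reached in the first `J`
rounds in which the side `S` of the copy can be active. This refers to the chain without the later
copies, so that it depends only on the relay vertices up to copy `i`. -/
def IsFastCopy (σ : Strategy (ChainVertex k m) M) (J : ℕ) (g : Fin k → CoreN m) (i : Fin k) :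
    Prop :=
  ∃ b, (∀ z, ¬ Informed (chainUpTo g i) root σ b (inS i z)) ∧
    Informed (chainUpTo g i) root σ (b + 1 + J) (inN i (g i))

theorem isFastCopy_congr (h : ∀ j ≤ i, g j = g' j) :
    IsFastCopy σ J g i ↔ IsFastCopy σ J g' i := by
  unfold IsFastCopy
  rw [chainUpTo_congr fun j hj => h j hj.le, h i le_rfl]

theorem ncard_isFastCopy_update_le :
    {v | IsFastCopy σ J (Function.update g i v) i}.ncard ≤ J * (2 * 2 ^ m) := by
  refine le_trans (Set.ncard_le_ncard ?_)
    (ncard_exists_informed_le (G := chainUpTo g i) (src := root) (σ := σ) (n := inN i)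
      (fun v => Option.some_ne_none _) ncard_existsUnique_chainUpTo_adj_le J)
  rintro v ⟨b, hS, hN⟩
  rw [chainUpTo_congr (g' := g) fun j hj => Function.update_of_ne hj.ne _ _] at hS hN
  rw [Function.update_self] at hN
  refine ⟨b, fun v' u hu => ?_, hN⟩
  obtain ⟨z, rfl, -⟩ := chainUpTo_adj_inN.1 hu
  exact hS z

theorem reachTime_relay_add_one_le (j : Fin (k + 1)) {x : ChainVertex k m}
    (hx : 2 * j < level x) :
    reachTime (chain g) root σ (relay g j) + 1 ≤ reachTime (chain g) root σ x :=
  reachTime_add_one_le_of_boundary (U := {x | 2 * j < level x}) (Nat.not_lt_zero _)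
    (fun _ hx _ hy hadj => eq_relay_of_adj hadj hx (not_lt.1 hy)) hx

theorem informed_chainUpTo_iff {t : ℕ} (ht : t ≤ reachTime (chain g) root σ (relay g i.succ))
    {x : ChainVertex k m} (hx : level x ≤ 2 * i + 2) :
    Informed (chainUpTo g i) root σ t x ↔ Informed (chain g) root σ t x := by
  have uninformed_beyond (t' : ℕ) (ht' : t' < t) (y : ChainVertex k m)
      (hy : ¬ level y ≤ 2 * i + 2) : ¬ Informed (chain g) root σ t' y := by
    intro h
    have hle := (reachTime_relay_add_one_le i.succ (by rw [Fin.val_succ]; omega)).trans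
      (reachTime_le_iff.2 h)
    exact absurd ((add_le_add_left ht 1).trans hle) (by norm_cast; omega)
  unfold Informed
  rw [chainUpTo,
    ← history_eq_history_induce (U := {x | level x ≤ 2 * i + 2}) uninformed_beyond hx]

theorem reachTime_relay_add_le (hslow : ¬ IsFastCopy σ J g i) :
    reachTime (chain g) root σ (relay g i.castSucc) + (J + 2 : ℕ) ≤
      reachTime (chain g) root σ (relay g i.succ) := by
  by_contra! hlt
  obtain ⟨T, hT⟩ := ENat.ne_top_iff_exists.1 hlt.ne_top
  rw [← hT] at hlt
  have informed_iff {t : ℕ} (ht : t ≤ T) {x : ChainVertex k m} (hx : level x ≤ 2 * i + 2) :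
      Informed (chainUpTo g i) root σ t x ↔ Informed (chain g) root σ t x :=
    informed_chainUpTo_iff (by rw [← hT]; exact_mod_cast ht) hx
  refine hslow ⟨T - (J + 1), fun z h => ?_, Informed.mono (t := T) (by omega) ?_⟩
  · rw [informed_iff (Nat.sub_le _ _) (Nat.le_succ _)] at h
    have hle := (reachTime_relay_add_one_le i.castSucc (x := inS i z) (Nat.lt_succ_self _)).trans
      (reachTime_le_iff.2 h)
    obtain ⟨r, hr⟩ := ENat.ne_top_iff_exists.1 (ne_top_of_le_ne_top (ENat.natCast_ne_top _)
      (le_self_add.trans hle))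
    rw [← hr] at hle hlt
    norm_cast at hle hlt
    omega
  · exact (informed_iff le_rfl le_rfl).2 (reachTime_le_iff.1 hT.ge)

theorem reachTime_relay_le_succ :
    reachTime (chain g) root σ (relay g i.castSucc) ≤ reachTime (chain g) root σ (relay g i.succ) :=
  le_self_add.trans (reachTime_relay_add_one_le i.castSucc
    (by rw [level_relay, Fin.val_succ, Fin.val_castSucc]; omega))

theorem sum_le_last_of_add_le_succ {α : Type*} [AddCommMonoid α] [PartialOrder α]
    [IsOrderedAddMonoid α] {k : ℕ} {f : Fin (k + 1) → α} {d : Fin k → α} (h₀ : 0 ≤ f 0)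
    (h : ∀ i, f i.castSucc + d i ≤ f i.succ) : ∑ i, d i ≤ f (Fin.last k) := by
  induction k with
  | zero => simpa using h₀
  | succ k ih =>
    rw [Fin.sum_univ_castSucc]
    exact (add_le_add_left (ih (f := fun i => f i.castSucc) h₀ fun i => h i.castSucc) _).trans
      (h (Fin.last k))

open Classical in
theorem card_slow_mul_le_reachTime :
    ((Finset.univ.filter fun i => ¬ IsFastCopy σ J g i).card * (J + 2) : ℕ) ≤
      reachTime (chain g) root σ (relay g (Fin.last k)) := by
  have sum_eq : (((Finset.univ.filter fun i => ¬ IsFastCopy σ J g i).card * (J + 2) : ℕ) : ℕ∞) =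
      ∑ i, if IsFastCopy σ J g i then 0 else ((J + 2 : ℕ) : ℕ∞) := by
    simp_rw [← ite_not (IsFastCopy σ J g _)]
    rw [← Finset.sum_filter, Finset.sum_const, nsmul_eq_mul, Nat.cast_mul]
  rw [sum_eq]
  refine sum_le_last_of_add_le_succ (f := fun j => reachTime (chain g) root σ (relay g j)) zero_le
    fun i => ?_
  split_ifs with hfast
  · simpa using reachTime_relay_le_succ
  · exact reachTime_relay_add_le hfast

end Chain

/-! ### Adapted events in product spaces -/

section Adapted

open scoped ENNReal

variable {ι : Type*} [LinearOrder ι] {α : ι → Type*} [∀ i, MeasurableSpace (α i)]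
  {μ : ∀ i, Measure (α i)}

theorem lmarginal_prod_adapted_le [∀ i, SigmaFinite (μ i)] {f : ι → (∀ i, α i) → ℝ≥0∞}
    {C : ι → ℝ≥0∞} (hf : ∀ i, Measurable (f i))
    (hadapted : ∀ i j, j < i → ∀ x v, f j (Function.update x i v) = f j x)
    (hC : ∀ i x, ∫⁻ v, f i (Function.update x i v) ∂μ i ≤ C i) (F : Finset ι) (x : ∀ i, α i) :
    lmarginal μ F (fun x => ∏ i ∈ F, f i x) x ≤ ∏ i ∈ F, C i := by
  induction F using Finset.induction_on_max with
  | empty => simp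
  | insert i F hmax ih =>
    have hi : i ∉ F := fun h => lt_irrefl _ (hmax i h)
    have hprod : Measurable fun x => ∏ j ∈ F, f j x := Finset.measurable_fun_prod F fun j _ => hf j
    have inner_le (y : ∀ i, α i) :
        ∫⁻ v, ∏ j ∈ insert i F, f j (Function.update y i v) ∂μ i ≤ (∏ j ∈ F, f j y) * C i :=
      calc ∫⁻ v, ∏ j ∈ insert i F, f j (Function.update y i v) ∂μ i
          = ∫⁻ v, (∏ j ∈ F, f j y) * f i (Function.update y i v) ∂μ i := by
            refine lintegral_congr fun v => ?_
            rw [Finset.prod_insert hi, mul_comm,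
              Finset.prod_congr rfl fun j hj => hadapted i j (hmax j hj) y v]
        _ = (∏ j ∈ F, f j y) * ∫⁻ v, f i (Function.update y i v) ∂μ i :=
            lintegral_const_mul _ ((hf i).comp (measurable_update y))
        _ ≤ (∏ j ∈ F, f j y) * C i := mul_le_mul_right (hC i y) _
    rw [lmarginal_insert' _ (Finset.measurable_fun_prod _ fun j _ => hf j) hi,
      Finset.prod_insert hi, mul_comm]
    calc lmarginal μ F (fun y => ∫⁻ v, ∏ j ∈ insert i F, f j (Function.update y i v) ∂μ i) x
        ≤ lmarginal μ F (fun y => (∏ j ∈ F, f j y) * C i) x := lmarginal_mono inner_le x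
      _ = lmarginal μ F (fun y => ∏ j ∈ F, f j y) x * C i :=
          lintegral_mul_const _ (hprod.comp measurable_updateFinset)
      _ ≤ (∏ j ∈ F, C j) * C i := mul_le_mul_left ih _

variable [Fintype ι] [∀ i, IsProbabilityMeasure (μ i)]

theorem lintegral_pi_prod_adapted_le {f : ι → (∀ i, α i) → ℝ≥0∞} {C : ι → ℝ≥0∞}
    (hf : ∀ i, Measurable (f i))
    (hadapted : ∀ i j, j < i → ∀ x v, f j (Function.update x i v) = f j x)
    (hC : ∀ i x, ∫⁻ v, f i (Function.update x i v) ∂μ i ≤ C i) :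
    ∫⁻ x, ∏ i, f i x ∂Measure.pi μ ≤ ∏ i, C i := by
  obtain ⟨x⟩ := (Measure.pi μ).nonempty_of_neZero
  rw [lintegral_eq_lmarginal_univ x]
  exact lmarginal_prod_adapted_le hf hadapted hC Finset.univ x

open Classical in
theorem pow_mul_pi_le_card_adapted_le {E : ι → Set (∀ i, α i)} {ε a : ℝ≥0∞}
    (hE : ∀ i, MeasurableSet (E i))
    (hadapted : ∀ i j, j < i → ∀ x v, Function.update x i v ∈ E j ↔ x ∈ E j)
    (hε : ∀ i x, μ i {v | Function.update x i v ∈ E i} ≤ ε) (ha : 1 ≤ a) (r : ℕ) :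
    a ^ r * Measure.pi μ {x | r ≤ (Finset.univ.filter fun i => x ∈ E i).card} ≤
      (a * ε + 1) ^ Fintype.card ι := by
  let weight (i : ι) (x : ∀ i, α i) : ℝ≥0∞ := if x ∈ E i then a else 1
  have weight_measurable (i : ι) : Measurable (weight i) :=
    Measurable.ite (hE i) measurable_const measurable_const
  have weight_adapted (i j : ι) (hij : j < i) (x : ∀ i, α i) (v : α i) :
      weight j (Function.update x i v) = weight j x := by
    simp only [weight, hadapted i j hij]
  have lintegral_weight_le (i : ι) (x : ∀ i, α i) :
      ∫⁻ v, weight i (Function.update x i v) ∂μ i ≤ a * ε + 1 := by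
    have hmeas : MeasurableSet {v | Function.update x i v ∈ E i} := measurable_update x (hE i)
    calc ∫⁻ v, weight i (Function.update x i v) ∂μ i
        ≤ ∫⁻ v, {v | Function.update x i v ∈ E i}.indicator (fun _ => a) v + 1 ∂μ i := by
          refine lintegral_mono fun v => ?_
          by_cases hv : Function.update x i v ∈ E i <;> simp [weight, hv]
      _ = a * μ i {v | Function.update x i v ∈ E i} + 1 := by
          rw [lintegral_add_right _ measurable_const, lintegral_indicator_const hmeas,
            lintegral_const, measure_univ, mul_one]
      _ ≤ a * ε + 1 := by gcongr; exact hε i x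
  have prod_weight (x : ∀ i, α i) :
      ∏ i, weight i x = a ^ (Finset.univ.filter fun i => x ∈ E i).card := by
    rw [Finset.prod_ite, Finset.prod_const, Finset.prod_const_one, mul_one]
  calc a ^ r * Measure.pi μ {x | r ≤ (Finset.univ.filter fun i => x ∈ E i).card}
      ≤ a ^ r * Measure.pi μ {x | a ^ r ≤ ∏ i, weight i x} := by
        refine mul_le_mul_right (measure_mono fun x hx => ?_) _
        rw [Set.mem_ofPred_eq, prod_weight]
        exact pow_le_pow_right₀ ha hx
    _ ≤ ∫⁻ x, ∏ i, weight i x ∂Measure.pi μ :=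
        mul_meas_ge_le_lintegral (Finset.measurable_fun_prod _ fun i _ => weight_measurable i) _
    _ ≤ ∏ _i, (a * ε + 1) :=
        lintegral_pi_prod_adapted_le weight_measurable weight_adapted lintegral_weight_le
    _ = (a * ε + 1) ^ Fintype.card ι := by rw [Finset.prod_const, Finset.card_univ]

end Adapted

/-! ### Measurability -/

section Measurability

variable {V M Ω : Type*} [Finite V] [Countable M] [MeasurableSpace Ω] {G : SimpleGraph V}
  {src : V} {σ : Ω → Strategy V M}

theorem measurableSet_preimage_of_countable {α : Type*} [Countable α] {f : Ω → α}
    (h : ∀ a, MeasurableSet {ω | f ω = a}) (s : Set α) : MeasurableSet (f ⁻¹' s) := by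
  rw [← Set.biUnion_preimage_singleton]
  exact MeasurableSet.biUnion s.to_countable fun a _ => h a

theorem measurableSet_history (hσ : ∀ v h a, MeasurableSet {ω | σ ω v h = a}) (t : ℕ) (v : V)
    (h : List (Option M)) : MeasurableSet {ω | history G src (σ ω) t v = h} := by
  induction t generalizing v h with
  | zero => simp [history]
  | succ t ih =>
    have measurable_action (u : V) (b : Option M) :
        MeasurableSet {ω | action src (σ ω) u (history G src (σ ω) t u) = b} := by
      have eq_iUnion : {ω | action src (σ ω) u (history G src (σ ω) t u) = b} =
          ⋃ l, {ω | history G src (σ ω) t u = l} ∩ {ω | action src (σ ω) u l = b} := by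
        ext ω; simp
      rw [eq_iUnion]
      refine MeasurableSet.iUnion fun l => (ih u l).inter ?_
      unfold action
      split_ifs
      · exact hσ u l b
      · exact MeasurableSet.const _
    have measurable_actions (a : V → Option M) :
        MeasurableSet {ω | (fun u => action src (σ ω) u (history G src (σ ω) t u)) = a} := by
      simp only [funext_iff, Set.ofPred_forall]
      exact MeasurableSet.iInter fun u => measurable_action u (a u)
    have eq_iUnion : {ω | history G src (σ ω) (t + 1) v = h} =
        ⋃ l, {ω | history G src (σ ω) t v = l} ∩
          (fun ω u => action src (σ ω) u (history G src (σ ω) t u)) ⁻¹'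
            {a | received G a v :: l = h} := by
      ext ω; simp [history]
    rw [eq_iUnion]
    exact MeasurableSet.iUnion fun l => (ih v l).inter
      (measurableSet_preimage_of_countable measurable_actions _)

theorem measurableSet_informed (hσ : ∀ v h a, MeasurableSet {ω | σ ω v h = a}) (t : ℕ) (v : V) :
    MeasurableSet {ω | Informed G src (σ ω) t v} :=
  measurableSet_preimage_of_countable (measurableSet_history hσ t v) {h | Active src v h}

theorem measurable_reachTime (hσ : ∀ v h a, MeasurableSet {ω | σ ω v h = a}) (v : V) :
    Measurable fun ω => reachTime G src (σ ω) v := by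
  refine ENat.measurable_iff.2 fun n => ?_
  have preimage_eq : (fun ω => reachTime G src (σ ω) v) ⁻¹' {(n : ℕ∞)} =
      {ω | Informed G src (σ ω) n v} \ ⋃ t < n, {ω | Informed G src (σ ω) t v} := by
    ext ω
    simp only [Set.mem_preimage, Set.mem_singleton_iff, Set.mem_sdiff, Set.mem_ofPred_eq,
      Set.mem_iUnion, not_exists, ← reachTime_le_iff, le_antisymm_iff]
    refine and_congr_right fun _ => ⟨fun h t ht ht' => ?_, fun h => le_iInf₂ fun t ht => ?_⟩
    · exact absurd (h.trans ht') (by exact_mod_cast ht.not_ge)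
    · by_contra! hlt
      exact h t (by exact_mod_cast hlt) (reachTime_le_iff.2 ht)
  rw [preimage_eq]
  exact (measurableSet_informed hσ n v).diff (MeasurableSet.biUnion (Set.to_countable _)
    fun t _ => measurableSet_informed hσ t v)

end Measurability

/-! ### The random chain -/

section RandomChain

variable {k m : ℕ} {M : Type*}

/-- The number of rounds that the message needs if `k / 2 + 1` of the `k` copies are not fast, where
the first `(m + 1) / 32` rounds of a copy reach at most `1 / 16` of its side `N`. -/
def slowTime (k m : ℕ) : ℕ := (k / 2 + 1) * ((m + 1) / 32 + 2)

theorem card_coreN : Fintype.card (CoreN m) = (m + 1) * 2 ^ m := by simp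

theorem uniformOn_univ_le_of_mul_ncard_le {α : Type*} [Fintype α] [Nonempty α] [MeasurableSpace α]
    [MeasurableSingletonClass α] {s : Set α} {q : ℕ} (h : q * s.ncard ≤ Fintype.card α) :
    ProbabilityTheory.uniformOn Set.univ s ≤ (q : ENNReal)⁻¹ := by
  have hcard : (Fintype.card α : ENNReal) ≠ 0 := by simp
  rw [ProbabilityTheory.uniformOn_univ, Measure.count_apply s.toFinite.measurableSet,
    ← s.toFinite.cast_ncard_eq]
  refine ENNReal.div_le_of_le_mul ?_
  rw [← ENNReal.div_eq_inv_mul, ENNReal.le_div_iff_mul_le (.inr hcard) (.inr (by simp)), mul_comm]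
  exact_mod_cast h

theorem uniformOn_isFastCopy_update_le (σ : Strategy (ChainVertex k m) M) (g : Fin k → CoreN m)
    (i : Fin k) :
    ProbabilityTheory.uniformOn Set.univ
      {v | IsFastCopy σ ((m + 1) / 32) (Function.update g i v) i} ≤ 16⁻¹ := by
  refine uniformOn_univ_le_of_mul_ncard_le (q := 16) ?_
  calc 16 * {v | IsFastCopy σ ((m + 1) / 32) (Function.update g i v) i}.ncard
      ≤ 16 * ((m + 1) / 32 * (2 * 2 ^ m)) := Nat.mul_le_mul_left _ ncard_isFastCopy_update_le
    _ = 32 * ((m + 1) / 32) * 2 ^ m := by ring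
    _ ≤ (m + 1) * 2 ^ m := Nat.mul_le_mul_right _ (Nat.mul_div_le _ _)
    _ = Fintype.card (CoreN m) := card_coreN.symm

instance : IsProbabilityMeasure (selection k m) := by
  unfold selection; infer_instance

open Classical in
theorem selection_le_card_isFastCopy_le (σ : Strategy (ChainVertex k m) M) {r : ℕ}
    (hr : k ≤ 2 * r) :
    selection k m {g | r ≤ (Finset.univ.filter fun i => IsFastCopy σ ((m + 1) / 32) g i).card} ≤
      2⁻¹ ^ k := by
  have markov := pow_mul_pi_le_card_adapted_le (r := r) (a := 16) (ε := 16⁻¹)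
    (μ := fun _ : Fin k => ProbabilityTheory.uniformOn (Set.univ : Set (CoreN m)))
    (E := fun i => {g | IsFastCopy σ ((m + 1) / 32) g i}) (fun _ => .of_discrete)
    (fun i j hij g v => isFastCopy_congr fun l hl =>
      Function.update_of_ne (hl.trans_lt hij).ne _ _)
    (fun i g => uniformOn_isFastCopy_update_le σ g i) (by norm_num)
  rw [ENNReal.mul_inv_cancel (by simp) (by simp), one_add_one_eq_two, Fintype.card_fin] at markov
  have four_pow_le : (2 : ENNReal) ^ k * 2 ^ k ≤ 16 ^ r := by
    rw [← pow_add]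
    calc (2 : ENNReal) ^ (k + k) ≤ 2 ^ (4 * r) := pow_le_pow_right₀ one_le_two (by omega)
      _ = 16 ^ r := by rw [pow_mul]; norm_num
  rw [← ENNReal.inv_pow, ENNReal.le_inv_iff_mul_le]
  refine (ENNReal.mul_le_mul_iff_right (a := 2 ^ k) (by simp) (by simp)).1 ?_
  rw [mul_one, mul_left_comm, mul_comm]
  exact (mul_le_mul_left (mul_comm (2 ^ k : ENNReal) _ ▸ four_pow_le) _).trans markov

theorem selection_reachTime_lt_slowTime_le (σ : Strategy (ChainVertex k m) M) :
    selection k m {g | reachTime (chain g) root σ (relay g (Fin.last k)) < slowTime k m} ≤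
      2⁻¹ ^ k := by
  classical
  refine le_trans (measure_mono fun g hg => ?_)
    (selection_le_card_isFastCopy_le σ (r := k - k / 2) (by omega))
  have slow_mul_lt := (card_slow_mul_le_reachTime (σ := σ) (J := (m + 1) / 32) (g := g)).trans_lt hg
  rw [Nat.cast_lt, slowTime] at slow_mul_lt
  have slow_lt := lt_of_mul_lt_mul_right slow_mul_lt (Nat.zero_le _)
  have card_add := Finset.card_filter_add_card_filter_not (s := (Finset.univ : Finset (Fin k)))
    (fun i => IsFastCopy σ ((m + 1) / 32) g i)
  rw [Finset.card_univ, Fintype.card_fin] at card_add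
  rw [Set.mem_ofPred_eq]
  omega

variable {Ω : Type*} [Countable M] [MeasurableSpace Ω] {P : Measure Ω} [IsProbabilityMeasure P]
  {σ : Ω → Strategy (ChainVertex k m) M}

theorem measurable_reachTime_relay (hσ : ∀ v h a, MeasurableSet {ω | σ ω v h = a})
    (j : Fin (k + 1)) :
    Measurable fun x : (Fin k → CoreN m) × Ω =>
      reachTime (chain x.1) root (σ x.2) (relay x.1 j) := by
  refine measurable_from_prod_countable_right fun g => ?_
  exact measurable_reachTime (G := chain g) hσ (relay g j)

theorem one_sub_le_slowTime_le_reachTime (hσ : ∀ v h a, MeasurableSet {ω | σ ω v h = a}) :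
    1 - (2⁻¹ : ℝ) ^ k ≤ ((selection k m).prod P).real
      {x | slowTime k m ≤ reachTime (chain x.1) root (σ x.2) (relay x.1 (Fin.last k))} := by
  set slowEvent : Set ((Fin k → CoreN m) × Ω) :=
    {x | slowTime k m ≤ reachTime (chain x.1) root (σ x.2) (relay x.1 (Fin.last k))}
  have hmeas : MeasurableSet slowEvent :=
    measurable_reachTime_relay hσ _ (Set.to_countable (Set.Ici (slowTime k m : ℕ∞))).measurableSet
  have compl_eq : slowEventᶜ =
      {x | reachTime (chain x.1) root (σ x.2) (relay x.1 (Fin.last k)) < slowTime k m} := by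
    ext x
    simp only [slowEvent, Set.mem_compl_iff, Set.mem_ofPred_eq, not_le]
  have compl_le : ((selection k m).prod P) slowEventᶜ ≤ 2⁻¹ ^ k := by
    rw [Measure.prod_apply_symm hmeas.compl]
    calc ∫⁻ ω, selection k m ((fun g => (g, ω)) ⁻¹' slowEventᶜ) ∂P
        ≤ ∫⁻ _, 2⁻¹ ^ k ∂P := lintegral_mono fun ω => by
          rw [compl_eq]
          exact selection_reachTime_lt_slowTime_le (σ ω)
      _ = 2⁻¹ ^ k := by rw [lintegral_const, measure_univ, mul_one]
  have compl_real_le : ((selection k m).prod P).real slowEventᶜ ≤ (2⁻¹ : ℝ) ^ k := by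
    simpa [measureReal_def] using ENNReal.toReal_mono (by simp) compl_le
  rw [probReal_compl_eq_one_sub hmeas] at compl_real_le
  linarith

theorem one_sub_le_ofReal_le_reachTime (hσ : ∀ v h a, MeasurableSet {ω | σ ω v h = a}) {x₀ : ℝ}
    (hx₀ : x₀ ≤ slowTime k m) :
    1 - (2⁻¹ : ℝ) ^ k ≤ ((selection k m).prod P).real
      {x | ENNReal.ofReal x₀ ≤
        (reachTime (chain x.1) root (σ x.2) (relay x.1 (Fin.last k)) : ENNReal)} := by
  refine (one_sub_le_slowTime_le_reachTime hσ).trans (measureReal_mono fun x hx => ?_)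
  calc ENNReal.ofReal x₀ ≤ slowTime k m := ENNReal.ofReal_le_natCast.2 hx₀
    _ ≤ _ := by exact_mod_cast ENat.toENNReal_le.2 hx

theorem ofReal_le_lintegral_reachTime (hk : 1 ≤ k)
    (hσ : ∀ v h a, MeasurableSet {ω | σ ω v h = a}) {x₀ : ℝ} (hx₀ : 2 * x₀ ≤ slowTime k m) :
    ENNReal.ofReal x₀ ≤
      ∫⁻ x, (reachTime (chain x.1) root (σ x.2) (relay x.1 (Fin.last k)) : ENNReal)
        ∂((selection k m).prod P) := by
  set μ := (selection k m).prod P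
  set R : (Fin k → CoreN m) × Ω → ENNReal := fun x =>
    reachTime (chain x.1) root (σ x.2) (relay x.1 (Fin.last k))
  have hR : Measurable R := Measurable.of_discrete.comp (measurable_reachTime_relay hσ _)
  have half_le : 2⁻¹ ≤ μ.real {x | ENNReal.ofReal (2 * x₀) ≤ R x} := by
    have := pow_le_of_le_one (by norm_num : (0 : ℝ) ≤ 2⁻¹) (by norm_num) (by omega : k ≠ 0)
    have := one_sub_le_ofReal_le_reachTime (P := P) hσ hx₀
    linarith
  calc ENNReal.ofReal x₀ = ENNReal.ofReal (2 * x₀) * ENNReal.ofReal 2⁻¹ := by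
        rw [← ENNReal.ofReal_mul' (by norm_num)]; congr 1; ring
    _ ≤ ENNReal.ofReal (2 * x₀) * μ {x | ENNReal.ofReal (2 * x₀) ≤ R x} := by
        gcongr
        exact ENNReal.ofReal_le_of_le_toReal half_le
    _ ≤ ∫⁻ x, R x ∂μ := mul_meas_ge_le_lintegral hR _

end RandomChain

/-! ### Diameter and size of the chain -/

section Diameter

variable {k m : ℕ} {g : Fin k → CoreN m}

theorem level_le_add_length {x y : ChainVertex k m} (p : (chain g).Walk x y) :
    level y ≤ level x + p.length := by
  induction p with
  | nil => exact Nat.le_add_right _ _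
  | cons h p ih =>
    have := level_eq_of_adj h
    rw [SimpleGraph.Walk.length_cons]
    omega

theorem edist_relay_le_two (j : Fin k) (y : CoreS m ⊕ CoreN m) :
    (chain g).edist (relay g j.castSucc) (some (j, y)) ≤ 2 := by
  have edist_inS (z : CoreS m) : (chain g).edist (relay g j.castSucc) (inS j z) = 1 :=
    SimpleGraph.edist_eq_one_iff_adj.2 (relay_adj_inS j z)
  rcases y with z | v
  · exact (edist_inS z).le.trans one_le_two
  · have edist_inN : (chain g).edist (inS j v.2) (some (j, .inr v)) = 1 :=
      SimpleGraph.edist_eq_one_iff_adj.2 (inN_adj_inS (v := v) rfl).symm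
    refine (SimpleGraph.edist_triangle (v := inS j v.2)).trans ?_
    rw [edist_inS, edist_inN, one_add_one_eq_two]

theorem edist_relay_relay_le {a b : ℕ} (hab : a ≤ b) (hb : b < k + 1) :
    (chain g).edist (relay g ⟨a, by omega⟩) (relay g ⟨b, hb⟩) ≤ (2 * (b - a) : ℕ) := by
  induction b, hab using Nat.le_induction with
  | base => simp
  | succ b hab ih =>
    calc (chain g).edist (relay g ⟨a, by omega⟩) (relay g ⟨b + 1, hb⟩)
        ≤ (chain g).edist (relay g ⟨a, by omega⟩) (relay g ⟨b, by omega⟩) +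
            (chain g).edist (relay g ⟨b, by omega⟩) (relay g ⟨b + 1, hb⟩) :=
          SimpleGraph.edist_triangle
      _ ≤ (2 * (b - a) : ℕ) + 2 :=
          add_le_add (ih (by omega)) (edist_relay_le_two ⟨b, by omega⟩ (.inr (g _)))
      _ = (2 * (b + 1 - a) : ℕ) := by norm_cast; omega

theorem edist_root_le (j : Fin k) (y : CoreS m ⊕ CoreN m) :
    (chain g).edist root (some (j, y)) ≤ (2 * k + 2 : ℕ) := by
  calc (chain g).edist root (some (j, y))
      ≤ (chain g).edist root (relay g j.castSucc) +
          (chain g).edist (relay g j.castSucc) (some (j, y)) := SimpleGraph.edist_triangle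
    _ ≤ (2 * (j - 0) : ℕ) + 2 :=
        add_le_add (edist_relay_relay_le (Nat.zero_le j) (Nat.lt_succ_of_lt j.isLt))
          (edist_relay_le_two j y)
    _ ≤ (2 * k + 2 : ℕ) := by norm_cast; omega

theorem edist_copies_le {i j : Fin k} (hij : i ≤ j) (x y : CoreS m ⊕ CoreN m) :
    (chain g).edist (some (i, x)) (some (j, y)) ≤ (2 * k + 2 : ℕ) := by
  calc (chain g).edist (some (i, x)) (some (j, y))
      ≤ (chain g).edist (some (i, x)) (relay g i.castSucc) +
          ((chain g).edist (relay g i.castSucc) (relay g j.castSucc) +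
            (chain g).edist (relay g j.castSucc) (some (j, y))) :=
        SimpleGraph.edist_triangle.trans (add_le_add le_rfl SimpleGraph.edist_triangle)
    _ ≤ 2 + ((2 * (j - i) : ℕ) + 2) :=
        add_le_add (SimpleGraph.edist_comm.trans_le (edist_relay_le_two i x))
          (add_le_add (edist_relay_relay_le (Fin.le_def.1 hij) (by omega))
            (edist_relay_le_two j y))
    _ ≤ (2 * k + 2 : ℕ) := by norm_cast; omega

theorem ediam_chain_le (g : Fin k → CoreN m) : (chain g).ediam ≤ (2 * k + 2 : ℕ) := by
  refine SimpleGraph.ediam_le_of_edist_le fun x y => ?_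
  rcases x with _ | ⟨i, x⟩ <;> rcases y with _ | ⟨j, y⟩
  · simp
  · exact edist_root_le j y
  · exact SimpleGraph.edist_comm.trans_le (edist_root_le i x)
  · rcases le_total i j with h | h
    · exact edist_copies_le h x y
    · exact SimpleGraph.edist_comm.trans_le (edist_copies_le h y x)

theorem ediam_chain_ne_top (g : Fin k → CoreN m) : (chain g).ediam ≠ ⊤ :=
  ne_top_of_le_ne_top (ENat.natCast_ne_top _) (ediam_chain_le g)

theorem chain_connected (g : Fin k → CoreN m) : (chain g).Connected :=
  SimpleGraph.connected_of_ediam_ne_top (ediam_chain_ne_top g)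

theorem diam_chain_le (g : Fin k → CoreN m) : (chain g).diam ≤ 2 * k + 2 :=
  ENat.toNat_le_of_le_natCast (ediam_chain_le g)

theorem le_diam_chain (g : Fin k → CoreN m) : 2 * k ≤ (chain g).diam := by
  obtain ⟨p, length_eq⟩ := (chain_connected g).exists_walk_length_eq_dist root
    (relay g (Fin.last k))
  calc 2 * k ≤ p.length := by simpa [level_root, level_relay] using level_le_add_length p
    _ = (chain g).dist root (relay g (Fin.last k)) := length_eq
    _ ≤ (chain g).diam := SimpleGraph.dist_le_diam (ediam_chain_ne_top g)

end Diameter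

section Size

variable {k m n D : ℕ}

theorem card_chainVertex (k m : ℕ) : Nat.card (ChainVertex k m) = 1 + k * (2 ^ m * (m + 2)) := by
  simp only [ChainVertex, Nat.card_eq_fintype_card, Fintype.card_option, Fintype.card_prod,
    Fintype.card_sum, Fintype.card_fin]
  ring

theorem exists_card_chainVertex_le_lt (hk : 1 ≤ k) (hn : 2 * k + 1 ≤ n) :
    ∃ m, Nat.card (ChainVertex k m) ≤ n ∧ n < Nat.card (ChainVertex k (m + 1)) := by
  have lt_card : n < Nat.card (ChainVertex k n) := by
    rw [card_chainVertex]
    calc n < 1 + 1 * (1 * (n + 2)) := by omega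
      _ ≤ 1 + k * (2 ^ n * (n + 2)) := by gcongr; exact Nat.one_le_two_pow
  have hex : ∃ m, n < Nat.card (ChainVertex k m) := ⟨n, lt_card⟩
  classical
  obtain ⟨m, hm⟩ : ∃ m, Nat.find hex = m + 1 := Nat.exists_eq_succ_of_ne_zero fun h => by
    have := h ▸ Nat.find_spec hex
    rw [card_chainVertex, pow_zero] at this
    omega
  exact ⟨m, not_lt.1 (Nat.find_min hex (by omega)), hm ▸ Nat.find_spec hex⟩

theorem le_three_mul_card_chainVertex (h : n < Nat.card (ChainVertex k (m + 1))) :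
    n ≤ 3 * Nat.card (ChainVertex k m) := by
  rw [card_chainVertex] at h ⊢
  have : 3 * (k * (2 ^ m * (m + 2))) = k * (2 ^ (m + 1) * (m + 1 + 2)) + k * 2 ^ m * m := by ring
  omega

theorem le_mul_two_pow (hD : 0 < D) (h : n ≤ 3 * Nat.card (ChainVertex (D / 2) m)) :
    n ≤ D * 2 ^ (2 * m + 3) := by
  have le_two_pow : 2 ^ m * (m + 2) ≤ 2 ^ (2 * m + 1) := by
    calc 2 ^ m * (m + 2) ≤ 2 ^ m * 2 ^ (m + 1) := Nat.mul_le_mul_left _ Nat.lt_two_pow_self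
      _ = 2 ^ (2 * m + 1) := by ring
  have two_le : 2 ≤ 2 ^ (2 * m + 1) := Nat.le_self_pow (by omega) 2
  rw [card_chainVertex] at h
  calc n ≤ 3 * (1 + D / 2 * (2 ^ m * (m + 2))) := h
    _ ≤ 3 * (1 + D / 2 * 2 ^ (2 * m + 1)) := by gcongr
    _ = 3 + 3 * (D / 2) * 2 ^ (2 * m + 1) := by ring
    _ ≤ 4 * D * 2 ^ (2 * m + 1) := by nlinarith [Nat.div_mul_le_self D 2]
    _ = D * 2 ^ (2 * m + 3) := by ring

theorem logb_div_le (hD : 0 < D) (hn : 0 < n) (h : n ≤ 3 * Nat.card (ChainVertex (D / 2) m)) :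
    Real.logb 2 (n / D) ≤ 2 * m + 3 := by
  have hD₀ : (0 : ℝ) < D := Nat.cast_pos.2 hD
  rw [Real.logb_le_iff_le_rpow one_lt_two (by positivity), div_le_iff₀' hD₀]
  exact_mod_cast le_mul_two_pow hD h

theorem mul_logb_le_slowTime (hD : 0 < D) (hn : 0 < n)
    (h : n ≤ 3 * Nat.card (ChainVertex (D / 2) m)) :
    1 / 400 * D * Real.logb 2 (n / D) ≤ slowTime (D / 2) m := by
  have le_rounds : (m : ℝ) + 34 ≤ 32 * ((m + 1) / 32 + 2 : ℕ) := by
    have : m + 34 ≤ 32 * ((m + 1) / 32 + 2) := by omega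
    exact_mod_cast this
  have le_copies : (D : ℝ) ≤ 4 * (D / 2 / 2 + 1 : ℕ) := by
    have : D ≤ 4 * (D / 2 / 2 + 1) := by omega
    exact_mod_cast this
  calc 1 / 400 * D * Real.logb 2 (n / D) ≤ 1 / 400 * D * (2 * m + 3) := by
        gcongr
        exact logb_div_le hD hn h
    _ ≤ D * (m + 34) / 128 := by nlinarith [Nat.cast_nonneg (α := ℝ) D]
    _ ≤ 4 * (D / 2 / 2 + 1 : ℕ) * (32 * ((m + 1) / 32 + 2 : ℕ)) / 128 := by gcongr
    _ = slowTime (D / 2) m := by rw [slowTime, Nat.cast_mul]; ring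

theorem inv_two_pow_le_rpow_neg {C : ℝ} (hD : 2 ≤ D) (hn : 0 < n) (h : 3 * C * Real.logb 2 n ≤ D) :
    (2⁻¹ : ℝ) ^ (D / 2) ≤ (n : ℝ) ^ (-C) := by
  have le_copies : (D : ℝ) ≤ 3 * (D / 2 : ℕ) := by
    have : D ≤ 3 * (D / 2) := by omega
    exact_mod_cast this
  calc (2⁻¹ : ℝ) ^ (D / 2) = 2 ^ (-((D / 2 : ℕ) : ℝ)) := by
        rw [Real.rpow_neg zero_le_two, Real.rpow_natCast, inv_pow]
    _ ≤ 2 ^ (Real.logb 2 n * -C) :=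
        Real.rpow_le_rpow_of_exponent_le one_le_two (by linarith)
    _ = (n : ℝ) ^ (-C) := by
        rw [Real.rpow_mul zero_le_two,
          Real.rpow_logb two_pos one_lt_two.ne' (by exact_mod_cast hn)]

end Size

/-! ### A single core graph -/

theorem one_add_le_of_mul_card_le_ncard_informed {m : ℕ} {M : Type*}
    {σ : Strategy (ChainVertex 1 m) M} {g : Fin 1 → CoreN m} {i : ℝ} {t : ℕ}
    (hne : {v : CoreN m | Informed (chain g) root σ t (inN 0 v)}.Nonempty)
    (h : 2 * i / Real.logb 2 (2 * 2 ^ m) * (Nat.card (CoreN m) : ℝ) ≤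
      ({v : CoreN m | Informed (chain g) root σ t (inN 0 v)}.ncard : ℝ)) :
    1 + i ≤ (t : ℝ) := by
  obtain ⟨t, rfl⟩ : ∃ t', t = t' + 1 := Nat.exists_eq_succ_of_ne_zero <| by
    rintro rfl
    exact not_informed_zero (by simp [inN, root]) hne.some_mem
  have logb_eq : Real.logb 2 (2 * 2 ^ m) = m + 1 := by
    rw [← pow_succ', Real.logb_pow, Real.logb_self_eq_one one_lt_two, mul_one, Nat.cast_succ]
  have ncard_le : {v : CoreN m | Informed (chain g) root σ (t + 1) (inN 0 v)}.ncard ≤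
      t * (2 * 2 ^ m) := by
    rw [← chainUpTo_last g, show t + 1 = 0 + 1 + t by ring]
    refine ncard_informed_le (fun v => by simp [inN, root])
      (fun X => ncard_existsUnique_chainUpTo_adj_le X) (fun v u hadj => ?_) t
    obtain ⟨z, rfl, -⟩ := chainUpTo_adj_inN.1 hadj
    exact not_informed_zero (by simp [inS, root])
  have mul_le : i * (2 * 2 ^ m) ≤ t * (2 * 2 ^ m) := by
    calc i * (2 * 2 ^ m) = 2 * i / (m + 1) * ((m + 1) * 2 ^ m) := by field_simp
      _ = 2 * i / Real.logb 2 (2 * 2 ^ m) * Nat.card (CoreN m) := by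
          rw [logb_eq, Nat.card_eq_fintype_card, card_coreN]; push_cast; rfl
      _ ≤ t * (2 * 2 ^ m) := h.trans (by exact_mod_cast ncard_le)
  rw [Nat.cast_succ, add_comm]
  exact add_le_add_left (le_of_mul_le_mul_right mul_le (by positivity)) 1

end RadioBroadcast

theorem mainTheorem6 :
    -- the rounds needed to reach a fraction of the side `N` of one core graph, `s = 2 ^ m`
    (∀ (m : ℕ) (M : Type*) (σ : Strategy (ChainVertex 1 m) M) (g : Fin 1 → CoreN m) (i : ℝ) (t : ℕ),
      0 ≤ i → i ≤ Real.logb 2 (2 * 2 ^ m) / 2 →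
      {v : CoreN m | Informed (chain g) root σ t (inN 0 v)}.Nonempty →
      2 * i / Real.logb 2 (2 * 2 ^ m) * (Nat.card (CoreN m) : ℝ) ≤
        ({v : CoreN m | Informed (chain g) root σ t (inN 0 v)}.ncard : ℝ) →
      1 + i ≤ (t : ℝ)) ∧
    -- the lower bound on the broadcast time
    ∃ c : ℝ, 0 < c ∧ ∃ A : ℝ → ℝ, ∀ n D : ℕ, 2 ≤ D → 2 * (D / 2) + 1 ≤ n →
      ∃ m : ℕ,
        Nat.card (ChainVertex (D / 2) m) ≤ n ∧ n < Nat.card (ChainVertex (D / 2) (m + 1)) ∧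
        n ≤ 3 * Nat.card (ChainVertex (D / 2) m) ∧
        (∀ g : Fin (D / 2) → CoreN m, (chain g).Connected ∧
          2 * (D / 2) ≤ (chain g).diam ∧ (chain g).diam ≤ 2 * (D / 2) + 2) ∧
        ∀ (M : Type*) [Countable M] (Ω : Type*) [MeasurableSpace Ω]
          (P : Measure Ω) [IsProbabilityMeasure P] (σ : Ω → Strategy (ChainVertex (D / 2) m) M),
          (∀ v h a, MeasurableSet {ω | σ ω v h = a}) →
          -- in expectation
          (ENNReal.ofReal (c * D * Real.logb 2 (n / D)) ≤
              ∫⁻ x, (reachTime (chain x.1) root (σ x.2) (relay x.1 (Fin.last _)) : ENNReal)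
                ∂((selection (D / 2) m).prod P) ∧
            ENNReal.ofReal (c * D * Real.logb 2 (n / D)) ≤
              ∫⁻ x, (broadcastTime (chain x.1) root (σ x.2) : ENNReal)
                ∂((selection (D / 2) m).prod P)) ∧
          -- with high probability
          ∀ C : ℝ, A C * Real.logb 2 n ≤ D →
            1 - (n : ℝ) ^ (-C) ≤ ((selection (D / 2) m).prod P).real
              {x | ENNReal.ofReal (c * D * Real.logb 2 (n / D)) ≤
                (reachTime (chain x.1) root (σ x.2) (relay x.1 (Fin.last _)) : ENNReal)} ∧
            1 - (n : ℝ) ^ (-C) ≤ ((selection (D / 2) m).prod P).real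
              {x | ENNReal.ofReal (c * D * Real.logb 2 (n / D)) ≤
                (broadcastTime (chain x.1) root (σ x.2) : ENNReal)} := by
  refine ⟨fun m M σ g i t _ _ hne h => one_add_le_of_mul_card_le_ncard_informed hne h,
    1 / 800, by norm_num, fun C => 3 * C, fun n D hD hn => ?_⟩
  obtain ⟨m, card_le, lt_card⟩ := exists_card_chainVertex_le_lt (k := D / 2) (by omega) hn
  have le_three_mul := le_three_mul_card_chainVertex lt_card
  refine ⟨m, card_le, lt_card, le_three_mul,
    fun g => ⟨chain_connected g, le_diam_chain g, diam_chain_le g⟩, ?_⟩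
  intro M _ Ω _ P _ σ hσ
  have two_mul_le : 2 * (1 / 800 * D * Real.logb 2 (n / D)) ≤ slowTime (D / 2) m :=
    (by ring : _ = _).trans_le (mul_logb_le_slowTime (by omega) (by omega) le_three_mul)
  have le_slowTime : 1 / 800 * D * Real.logb 2 (n / D) ≤ slowTime (D / 2) m := by
    linarith [Nat.cast_nonneg (α := ℝ) (slowTime (D / 2) m)]
  have reachTime_le (x : (Fin (D / 2) → CoreN m) × Ω) :
      (reachTime (chain x.1) root (σ x.2) (relay x.1 (Fin.last _)) : ENNReal) ≤
        broadcastTime (chain x.1) root (σ x.2) :=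
    ENat.toENNReal_le.2 (reachTime_le_broadcastTime _)
  have le_expectation := ofReal_le_lintegral_reachTime (P := P) (by omega) hσ two_mul_le
  refine ⟨⟨le_expectation, le_expectation.trans (lintegral_mono reachTime_le)⟩, fun C hC => ?_⟩
  have le_probability := (sub_le_sub_left (inv_two_pow_le_rpow_neg hD (by omega) hC) 1).trans
    (one_sub_le_ofReal_le_reachTime (P := P) hσ le_slowTime)
  exact ⟨le_probability,
    le_probability.trans (measureReal_mono fun x hx => hx.trans (reachTime_le x))⟩
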